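/- Let $\mathrm{SWAP}_5$ be the problem of deciding, for a finite sequence $[a_1\leftrightarrow b_1]\dots[a_m\leftrightarrow b_m]$ of swaps with $a_i\ne b_i$ in a five-element set (20 possible instructions), whether the composition of the transpositions $(a_i\,b_i)$ is the identity permutation. Then: (a) $\mathrm{SWAP}_5$ is $\mathsf{NC}^1$-complete under $\mathsf{AC}^0$-reductions. That is, it is decided by circuit families of fan-in two, polynomial size and depth $O(\log n)$, and every language over a finite alphabet that is decided by such a family has a many-one reduction to $\mathrm{SWAP}_5$, with output length polynomial and determined by the input length, computed by circuits of unbounded fan-in, polynomial size and constant depth. (Circuit families are non-uniform.) (b) $\mathrm{SWAP}_5$ is solved by one-layer PaTH transformers with two attention heads and $O(\log n)$ precision. That is, there are constants $D,d,k$ and a function $p(n)=O(\log n)$ such that for every $n$ there is a one-layer PaTH transformer with two heads, model dimension $D$, head dimension $d$ and feed-forward width $k$, all of whose parameters are floating-point numbers of precision $p(n)$, with the following property: for every rounding to precision $p(n)$ and every sequence of $m\le n$ swaps, on the input $\#\,[a_1\leftrightarrow b_1]\dots[a_m\leftrightarrow b_m]$, where $\#$ is a start token, the output computed in the last position is $1$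 if the swaps compose to the identity permutation, and $-1$ otherwise. Here a floating-point number of precision $p$ is a real number $\mu 2^{e}$ with integers $|\mu|<2^p$, $|e|<2^p$, and a rounding to precision $p$ is a monotone map from $\mathbb R$ to these numbers that fixes each of them (for instance rounding to nearest, or truncation). A one-layer PaTH transformer embeds the token in position $t\in\{0,\dots,m\}$ as a vector $\mathbf x_t\in\mathbb R^D$. Each head has matrices $\mathbf W_q,\mathbf W_k,\mathbf W_v,\mathbf W_w\in\mathbb R^{d\times D}$, a vector $\mathbf u\in\mathbb R^D$ and a number $b$, and computes $\mathbf q_t=\mathbf W_q\mathbf x_t$, $\mathbf k_t=\mathbf W_k\mathbf x_t$, $\mathbf v_t=\mathbf W_v\mathbf x_t$, $\mathbf w_t=\mathbf W_w\mathbf x_t/\lVert\mathbf W_w\mathbf x_t\rVert_2$ (or $\mathbf 0$ if $\mathbf W_w\mathbf x_t=\mathbf 0$), $\beta_t=2\operatorname{sigmoid}(\mathbf u^\top\mathbf x_t+b)$, $\mathbf H_t=\mathbf I-\beta_t\mathbf w_t\mathbf w_t^\top$, and its output in position $i$ is $$\mathbf o_i=\frac1{Z_i}\sum_{j=0}^{i}\exp\bigl(\mathbf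 k_j^\top\mathbf H_{j+1}\mathbf H_{j+2}\cdots\mathbf H_i\,\mathbf q_i\bigr)\,\mathbf v_j,\qquad Z_i=\sum_{j=0}^{i}\exp\bigl(\mathbf k_j^\top\mathbf H_{j+1}\mathbf H_{j+2}\cdots\mathbf H_i\,\mathbf q_i\bigr).$$ The concatenated head outputs are multiplied by an output matrix $\mathbf W_o\in\mathbb R^{D\times 2d}$, giving $\mathbf y\in\mathbb R^D$, and a feed-forward layer with $k$ hidden units gives the output $\mathbf c^\top\operatorname{sign}(\mathbf W_1\mathbf y+\mathbf b_1)+b_2$. In the computation with a given rounding, the rounding is applied, entry by entry, to each of the following: the vectors $\mathbf q_t,\mathbf k_t,\mathbf v_t$, $\mathbf W_w\mathbf x_t$, $\mathbf w_t$, the number $\mathbf u^\top\mathbf x_t+b$, $\beta_t$, the matrix $\mathbf H_t$, each successive row vector $\mathbf k_j^\top\mathbf H_{j+1}\cdots\mathbf H_s$ (computed from the rounded one before it), the logit, its exponential, the sum $Z_i$, each normalized attention weight, $\mathbf o_i$, $\mathbf y$, the argument of $\operatorname{sign}$, and the output. -/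

import Mathlib

namespace PaTH

/-! ## Boolean circuits, `NC¹` and `AC⁰`-reductions -/

/-- The operation performed by a gate of a circuit with input literals `ι` and gates `G`.  The
conjunction and disjunction gates have arbitrary fan-in; the empty ones are the constants. -/
inductive GateOp (ι G : Type) : Type
  | input (i : ι) : GateOp ι G
  | not (g : G) : GateOp ι G
  | and (S : Finset G) : GateOp ι G
  | or (S : Finset G) : GateOp ι G

/-- The gates wired into a gate. -/
def GateOp.children {ι G : Type} : GateOp ι G → Finset G
  | .input _ => ∅
  | .not g => {g}
  | .and S => S
  | .or S => S

/-- A Boolean circuit: a finite directed acyclic graph of gates with a designated output gate.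
The function `level` strictly increases along wires; it certifies acyclicity, and every path that
ends in a gate `g` has at most `level g` wires. -/
structure Circuit (ι : Type) : Type 1 where
  Gate : Type
  fintypeGate : Fintype Gate
  op : Gate → GateOp ι Gate
  level : Gate → ℕ
  level_lt : ∀ g, ∀ g' ∈ (op g).children, level g' < level g
  out : Gate

namespace Circuit

variable {ι : Type}

/-- The number of gates. -/
def size (C : Circuit ι) : ℕ := @Fintype.card C.Gate C.fintypeGate

/-- The depth (the level of the output gate). -/
def depth (C : Circuit ι) : ℕ := C.level C.out

/-- Every gate has at most two inputs. -/
def FanInTwo (C : Circuit ι) : Prop := ∀ g, (C.op g).children.card ≤ 2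

/-- The truth value of a gate under an assignment of truth values to the input literals. -/
def eval (C : Circuit ι) (x : ι → Prop) (g : C.Gate) : Prop :=
  match h : C.op g with
  | .input i => x i
  | .not g' => ¬ C.eval x g'
  | .and S => ∀ g' : S, C.eval x g'.1
  | .or S => ∃ g' : S, C.eval x g'.1
termination_by C.level g
decreasing_by
  · exact C.level_lt g g' (by simp [h, GateOp.children])
  · exact C.level_lt g g'.1 (by simp [h, GateOp.children])
  · exact C.level_lt g g'.1 (by simp [h, GateOp.children])

theorem eval_input (C : Circuit ι) (x : ι → Prop) (g : C.Gate) (i : ι)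
    (h : C.op g = .input i) : C.eval x g ↔ x i := by
  rw [eval]; split <;> simp_all

theorem eval_not (C : Circuit ι) (x : ι → Prop) (g g' : C.Gate)
    (h : C.op g = .not g') : C.eval x g ↔ ¬ C.eval x g' := by
  rw [eval]; split <;> simp_all

theorem eval_and (C : Circuit ι) (x : ι → Prop) (g : C.Gate) (S : Finset C.Gate)
    (h : C.op g = .and S) : C.eval x g ↔ ∀ g' ∈ S, C.eval x g' := by
  rw [eval]; split <;> simp_all

theorem eval_or (C : Circuit ι) (x : ι → Prop) (g : C.Gate) (S : Finset C.Gate)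
    (h : C.op g = .or S) : C.eval x g ↔ ∃ g' ∈ S, C.eval x g' := by
  rw [eval]; split <;> simp_all

/-- The circuit accepts the word `w` over the alphabet `α`.  The literal `(i, a)` stands for
"the letter in position `i` is `a`". -/
def Accepts {n : ℕ} {α : Type} (C : Circuit (Fin n × α)) (w : Fin n → α) : Prop :=
  C.eval (fun q => w q.1 = q.2) C.out

end Circuit

/-- The language `L` is in (non-uniform) `NC¹`: for each `n` its words of length `n` are decided
by a circuit of fan-in at most two, polynomial size and depth `O(log n)`. -/
def InNC1 {α : Type} (L : Language α) : Prop :=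
  ∃ c : ℕ, ∀ n : ℕ, ∃ C : Circuit (Fin n × α),
    C.FanInTwo ∧ C.size ≤ n ^ c + c ∧ C.depth ≤ c * Nat.log 2 n + c ∧
      ∀ w : Fin n → α, C.Accepts w ↔ List.ofFn w ∈ L

/-- (Non-uniform) `AC⁰` many-one reducibility: words of length `n` are mapped to words of
polynomial length `m`, the reduction preserves membership and non-membership, and each literal of
the image word is computed by a circuit of unbounded fan-in, polynomial size and constant depth. -/
def AC0Reducible {α β : Type} (L : Language α) (L' : Language β) : Prop :=
  ∃ c : ℕ, ∀ n : ℕ, ∃ m : ℕ, m ≤ n ^ c + c ∧ ∃ f : (Fin n → α) → (Fin m → β),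
    (∀ w : Fin n → α, List.ofFn w ∈ L ↔ List.ofFn (f w) ∈ L') ∧
      ∀ (j : Fin m) (b : β), ∃ C : Circuit (Fin n × α),
        C.size ≤ n ^ c + c ∧ C.depth ≤ c ∧ ∀ w : Fin n → α, C.Accepts w ↔ f w j = b

/-- `L` is complete for `NC¹` under `AC⁰`-reductions. -/
def NC1Complete {β : Type} (L : Language β) : Prop :=
  InNC1 L ∧ ∀ (α : Type) [Finite α] (L' : Language α), InNC1 L' → AC0Reducible L' L

/-! ## Iterated swaps of five elements -/

/-- The 20 instructions `[x ↔ y]` with `x ≠ y`. -/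
abbrev Swap : Type := {q : Fin 5 × Fin 5 // q.1 ≠ q.2}

/-- The transposition performed by an instruction. -/
def Swap.perm (s : Swap) : Equiv.Perm (Fin 5) := Equiv.swap s.1.1 s.1.2

/-- The sequences of swaps that compose to the identity permutation. -/
def swapIdentity : Language Swap := {w | (w.map Swap.perm).prod = 1}

theorem mem_swapIdentity (w : List Swap) :
    w ∈ swapIdentity ↔ (w.map Swap.perm).prod = 1 := Iff.rfl

/-- The 21 tokens: the start token `#` and the swaps. -/
inductive Token : Type
  | start : Token
  | swap (s : Swap) : Token

/-- The token sequence `# [a₁ ↔ b₁] … [aₙ ↔ bₙ]`. -/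
def tokens (w : List Swap) : List Token := Token.start :: w.map Token.swap

/-! ## Finite precision -/

/-- Floating-point numbers with precision `p`: `m · 2 ^ e`, where `m` and `e` are signed integers
of `p` bits each (plus the sign). -/
def floats (p : ℕ) : Set ℝ :=
  {x | ∃ m e : ℤ, |m| < 2 ^ p ∧ |e| < 2 ^ p ∧ x = (m : ℝ) * (2 : ℝ) ^ e}

/-- `r` is a rounding to precision `p`: monotone, with values in the floating-point numbers, and
exact on them.  Rounding to nearest with any rule for ties, truncation towards zero, and rounding
up or down (all saturating on overflow) are of this kind. -/
structure IsRounding (p : ℕ) (r : ℝ → ℝ) : Prop where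
  monotone : Monotone r
  mem : ∀ x, r x ∈ floats p
  exact : ∀ x ∈ floats p, r x = x

/-- Entrywise rounding. -/
def roundVec {d : ℕ} (r : ℝ → ℝ) (v : Fin d → ℝ) : Fin d → ℝ := fun a => r (v a)

/-! ## PaTH attention -/

/-- The parameters of a PaTH attention head with model dimension `D` and head dimension `d`. -/
structure Head (D d : ℕ) where
  Wq : Matrix (Fin d) (Fin D) ℝ
  Wk : Matrix (Fin d) (Fin D) ℝ
  Wv : Matrix (Fin d) (Fin D) ℝ
  Ww : Matrix (Fin d) (Fin D) ℝ
  u : Fin D → ℝ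
  b : ℝ

namespace Head

open Matrix

variable {D d : ℕ}

/-- All parameters are floating-point numbers of precision `p`. -/
def Representable (P : Head D d) (p : ℕ) : Prop :=
  (∀ a c, P.Wq a c ∈ floats p) ∧ (∀ a c, P.Wk a c ∈ floats p) ∧ (∀ a c, P.Wv a c ∈ floats p) ∧
    (∀ a c, P.Ww a c ∈ floats p) ∧ (∀ c, P.u c ∈ floats p) ∧ P.b ∈ floats p

/-- The query vector of an input vector. -/
def query (P : Head D d) (r : ℝ → ℝ) (x : Fin D → ℝ) : Fin d → ℝ := roundVec r (P.Wq *ᵥ x)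

/-- The key vector of an input vector. -/
def key (P : Head D d) (r : ℝ → ℝ) (x : Fin D → ℝ) : Fin d → ℝ := roundVec r (P.Wk *ᵥ x)

/-- The value vector of an input vector. -/
def value (P : Head D d) (r : ℝ → ℝ) (x : Fin D → ℝ) : Fin d → ℝ := roundVec r (P.Wv *ᵥ x)

/-- The coefficient `β = 2 sigmoid(uᵀx + b)`. -/
noncomputable def beta (P : Head D d) (r : ℝ → ℝ) (x : Fin D → ℝ) : ℝ :=
  r (2 * Real.sigmoid (r (P.u ⬝ᵥ x + P.b)))

/-- The linear image of the input vector that is normalized to give the direction `w`. -/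
def preDir (P : Head D d) (r : ℝ → ℝ) (x : Fin D → ℝ) : Fin d → ℝ := roundVec r (P.Ww *ᵥ x)

/-- The direction `w`: the linear image of the input, divided by its Euclidean norm (and `0` if
the linear image is `0`). -/
noncomputable def dir (P : Head D d) (r : ℝ → ℝ) (x : Fin D → ℝ) : Fin d → ℝ :=
  roundVec r (fun a => P.preDir r x a / √(P.preDir r x ⬝ᵥ P.preDir r x))

/-- The transition matrix `H = I - β w wᵀ`. -/
noncomputable def transition (P : Head D d) (r : ℝ → ℝ) (x : Fin D → ℝ) :
    Matrix (Fin d) (Fin d) ℝ :=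
  Matrix.of fun a c => r ((1 : Matrix (Fin d) (Fin d) ℝ) a c - P.beta r x * P.dir r x a * P.dir r x c)

/-- The row vector `k_jᵀ H_{j+1} H_{j+2} ⋯ H_{j+t}`, computed from left to right. -/
noncomputable def carry (P : Head D d) (r : ℝ → ℝ) (X : ℕ → Fin D → ℝ) (j : ℕ) : ℕ → Fin d → ℝ
  | 0 => P.key r (X j)
  | t + 1 => roundVec r (P.carry r X j t ᵥ* P.transition r (X (j + (t + 1))))

/-- The attention logit `k_jᵀ (H_{j+1} ⋯ H_i) q_i` from position `i` to position `j ≤ i`. -/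
noncomputable def logit (P : Head D d) (r : ℝ → ℝ) (X : ℕ → Fin D → ℝ) (i j : ℕ) : ℝ :=
  r (P.carry r X j (i - j) ⬝ᵥ P.query r (X i))

/-- The unnormalized attention weight. -/
noncomputable def score (P : Head D d) (r : ℝ → ℝ) (X : ℕ → Fin D → ℝ) (i j : ℕ) : ℝ :=
  r (Real.exp (P.logit r X i j))

/-- The softmax normalizer; attention is causal, over the positions `0, …, i`. -/
noncomputable def normalizer (P : Head D d) (r : ℝ → ℝ) (X : ℕ → Fin D → ℝ) (i : ℕ) : ℝ :=
  r (∑ j ∈ Finset.range (i + 1), P.score r X i j)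

/-- The attention weight. -/
noncomputable def weight (P : Head D d) (r : ℝ → ℝ) (X : ℕ → Fin D → ℝ) (i j : ℕ) : ℝ :=
  r (P.score r X i j / P.normalizer r X i)

/-- The output of the head in position `i`. -/
noncomputable def output (P : Head D d) (r : ℝ → ℝ) (X : ℕ → Fin D → ℝ) (i : ℕ) : Fin d → ℝ :=
  fun a => r (∑ j ∈ Finset.range (i + 1), P.weight r X i j * P.value r (X j) a)

end Head

/-- The parameters of a one-layer PaTH transformer over the vocabulary `V` with `h` attention
heads, model dimension `D`, head dimension `d` and feed-forward width `k`: token embeddings,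
heads, output projection of the concatenated heads, and a feed-forward layer with scalar output. -/
structure OneLayer (V : Type) (h D d k : ℕ) where
  emb : V → Fin D → ℝ
  head : Fin h → Head D d
  Wo : Matrix (Fin D) (Fin h × Fin d) ℝ
  W₁ : Matrix (Fin k) (Fin D) ℝ
  b₁ : Fin k → ℝ
  W₂ : Fin k → ℝ
  b₂ : ℝ

namespace OneLayer

open Matrix

variable {V : Type} {h D d k : ℕ}

/-- All parameters are floating-point numbers of precision `p`. -/
def Representable (T : OneLayer V h D d k) (p : ℕ) : Prop :=
  (∀ v c, T.emb v c ∈ floats p) ∧ (∀ m, (T.head m).Representable p) ∧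
    (∀ c q, T.Wo c q ∈ floats p) ∧ (∀ l c, T.W₁ l c ∈ floats p) ∧ (∀ l, T.b₁ l ∈ floats p) ∧
      (∀ l, T.W₂ l ∈ floats p) ∧ T.b₂ ∈ floats p

/-- The embedded input sequence (positions beyond its end are never attended to). -/
def embed (T : OneLayer V h D d k) (s : List V) : ℕ → Fin D → ℝ :=
  fun t => (s.map T.emb).getD t 0

/-- The projected concatenation of the outputs of the heads in position `i`. -/
noncomputable def attention (T : OneLayer V h D d k) (r : ℝ → ℝ) (s : List V) (i : ℕ) :
    Fin D → ℝ :=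
  roundVec r (T.Wo *ᵥ fun q => (T.head q.1).output r (T.embed s) i q.2)

/-- The feed-forward layer, with nonlinearity `sign`. -/
noncomputable def ffn (T : OneLayer V h D d k) (r : ℝ → ℝ) (y : Fin D → ℝ) : ℝ :=
  r (T.W₂ ⬝ᵥ (fun l => Real.sign (r ((T.W₁ *ᵥ y) l + T.b₁ l))) + T.b₂)

/-- The output of the transformer on a sequence, computed with the rounding `r`: the output of the
feed-forward layer in the last position. -/
noncomputable def run (T : OneLayer V h D d k) (r : ℝ → ℝ) (s : List V) : ℝ :=
  T.ffn r (T.attention r s (s.length - 1))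

end OneLayer

end PaTH

/-!
A product in a finite monoid is evaluated by a balanced binary tree, which puts word problems of
finite monoids into `NC¹`.  Conversely, following Barrington, every gate of a circuit of fan-in two
is simulated by a branching program over the 5-cycles of `S₅`: a conjunction becomes a commutator,
and a 5-cycle is a commutator of 5-cycles.  A branching program in which every instruction reads one
letter is an `AC⁰` reduction.

For the transformer, `β ≈ 2` and `w = (e_x - e_y) / √2` make `H = I - β w wᵀ` almost the permutation
matrix of the swap `[x ↔ y]`, so that the key `(1, …, 5)` of the start token reaches the last
position permuted by the product of the swaps; `O(log n)` bits keep the error accumulated in `n`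
steps small.  By the rearrangement inequality, the inner product with a suitable query is of order
`log n` if the permutation is trivial, and of order `-log n` otherwise.  All other tokens have
key `0`, hence score `1`, so at the scale of `log n` the start token takes a constant fraction of
the attention in the first case and a negligible one in the second.
-/

namespace PaTH

/-! ### Building circuits from circuits -/

attribute [instance] Circuit.fintypeGate

namespace GateOp

variable {ι G G' : Type}

/-- The operation `o` with its wires moved along `f`: a gate of a circuit as it appears in a larger
circuit. -/
def map (f : G ↪ G') : GateOp ι G → GateOp ι G'
  | .input i => .input i
  | .not g => .not (f g)
  | .and S => .and (S.map f)
  | .or S => .or (S.map f)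

/-- The truth value of the operation `o` on the input literals `x` and the truth values `v` of the
gates.  It turns the recursion for `Circuit.eval` into a single equation. -/
def Holds (o : GateOp ι G) (x : ι → Prop) (v : G → Prop) : Prop :=
  match o with
  | .input i => x i
  | .not g => ¬ v g
  | .and S => ∀ g ∈ S, v g
  | .or S => ∃ g ∈ S, v g

theorem children_map (f : G ↪ G') (o : GateOp ι G) :
    (o.map f).children = o.children.map f := by
  cases o <;> simp [map, children]

theorem card_children_map (f : G ↪ G') (o : GateOp ι G) :
    (o.map f).children.card = o.children.card := by
  rw [children_map, Finset.card_map]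

theorem holds_map (f : G ↪ G') (o : GateOp ι G) (x : ι → Prop) (v : G' → Prop) :
    (o.map f).Holds x v ↔ o.Holds x (v ∘ f) := by
  cases o <;> simp [map, Holds]

theorem holds_congr {o : GateOp ι G} {x : ι → Prop} {v v' : G → Prop}
    (h : ∀ g ∈ o.children, (v g ↔ v' g)) : o.Holds x v ↔ o.Holds x v' := by
  cases o with
  | input i => rfl
  | not g => exact not_congr (h g (Finset.mem_singleton_self g))
  | and S => exact forall₂_congr h
  | or S => exact exists_congr fun g => and_congr_right (h g)

end GateOp

namespace Circuit

variable {ι : Type}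

theorem eval_iff_holds (C : Circuit ι) (x : ι → Prop) (g : C.Gate) :
    C.eval x g ↔ (C.op g).Holds x (C.eval x) := by
  cases h : C.op g with
  | input i => exact C.eval_input x g i h
  | not g' => exact C.eval_not x g g' h
  | and S => exact C.eval_and x g S h
  | or S => exact C.eval_or x g S h

theorem eval_embedding {C C' : Circuit ι} (f : C.Gate ↪ C'.Gate)
    (hf : ∀ g, C'.op (f g) = (C.op g).map f) (x : ι → Prop) (g : C.Gate) :
    C'.eval x (f g) ↔ C.eval x g := by
  induction hl : C.level g using Nat.strong_induction_on generalizing g with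
  | _ l ih =>
    subst hl
    rw [C'.eval_iff_holds, C.eval_iff_holds, hf, GateOp.holds_map]
    exact GateOp.holds_congr fun g' hg' => ih _ (C.level_lt g g' hg') g' rfl

section Compose

variable {κ : Type} [Fintype κ]

/-- The circuit that applies the operation `o` to the outputs of the circuits `C k`, which are
placed side by side below the new output gate `none`. -/
def compose (o : GateOp ι κ) (C : κ → Circuit ι) : Circuit ι where
  Gate := Option (Σ k, (C k).Gate)
  fintypeGate := inferInstance
  op
    | none => o.map ⟨fun k => some ⟨k, (C k).out⟩, fun _ _ h => by cases h; rfl⟩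
    | some ⟨k, g⟩ => ((C k).op g).map ((Function.Embedding.sigmaMk k).trans .some)
  level
    | none => Finset.univ.sup fun k => (C k).depth + 1
    | some ⟨k, g⟩ => (C k).level g
  level_lt := by
    rintro (_ | ⟨k, g⟩) g' hg' <;> rw [GateOp.children_map, Finset.mem_map] at hg'
    · obtain ⟨k, -, rfl⟩ := hg'
      exact Finset.le_sup (f := fun k => (C k).depth + 1) (Finset.mem_univ k)
    · obtain ⟨g'', hg'', rfl⟩ := hg'
      exact (C k).level_lt g g'' hg''
  out := none

theorem eval_compose_out (o : GateOp ι κ) (C : κ → Circuit ι) (x : ι → Prop) :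
    (compose o C).eval x (compose o C).out ↔ o.Holds x fun k => (C k).eval x (C k).out := by
  rw [eval_iff_holds]
  refine (GateOp.holds_map _ o x _).trans (GateOp.holds_congr fun k _ => ?_)
  let f : (C k).Gate ↪ (compose o C).Gate :=
    (Function.Embedding.sigmaMk (β := fun k => (C k).Gate) k).trans .some
  exact eval_embedding f (fun _ => rfl) x (C k).out

theorem size_compose (o : GateOp ι κ) (C : κ → Circuit ι) :
    (compose o C).size = ∑ k, (C k).size + 1 :=
  Fintype.card_option.trans (congrArg (· + 1) Fintype.card_sigma)

theorem depth_compose (o : GateOp ι κ) (C : κ → Circuit ι) :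
    (compose o C).depth = Finset.univ.sup fun k => (C k).depth + 1 := rfl

theorem FanInTwo.compose {o : GateOp ι κ} (ho : o.children.card ≤ 2) {C : κ → Circuit ι}
    (hC : ∀ k, (C k).FanInTwo) : (compose o C).FanInTwo := by
  rintro (_ | ⟨k, g⟩)
  exacts [(GateOp.card_children_map _ _).trans_le ho,
    (GateOp.card_children_map _ _).trans_le (hC k g)]

end Compose

end Circuit

/-- The property `φ` of words of length `n` is decided by a circuit of fan-in two with `d` levels
of gates that is no larger than a formula with `d` levels. -/
def DecidedInLevels {n : ℕ} {α : Type} (d : ℕ) (φ : (Fin n → α) → Prop) : Prop :=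
  ∃ C : Circuit (Fin n × α), C.FanInTwo ∧ C.size < 2 ^ d ∧ C.depth < d ∧
    ∀ w, C.Accepts w ↔ φ w

namespace DecidedInLevels

variable {n : ℕ} {α : Type} {d d' : ℕ} {φ ψ : (Fin n → α) → Prop}

theorem mono (h : DecidedInLevels d φ) (hd : d ≤ d') : DecidedInLevels d' φ :=
  let ⟨C, hfan, hsize, hdepth, hC⟩ := h
  ⟨C, hfan, hsize.trans_le (Nat.pow_le_pow_right two_pos hd), hdepth.trans_le hd, hC⟩

theorem congr (h : DecidedInLevels d φ) (hφ : ∀ w, φ w ↔ ψ w) : DecidedInLevels d ψ :=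
  funext (fun w => propext (hφ w)) ▸ h

theorem gate {κ : Type} [Fintype κ] (hκ : Fintype.card κ ≤ 2) (o : GateOp (Fin n × α) κ)
    {φ : κ → (Fin n → α) → Prop} (h : ∀ k, DecidedInLevels d (φ k)) :
    DecidedInLevels (d + 1) fun w => o.Holds (fun q => w q.1 = q.2) fun k => φ k w := by
  choose C hfan hsize hdepth hC using h
  refine ⟨.compose o C, .compose ((Finset.card_le_univ _).trans hκ) hfan, ?_, ?_, fun w => ?_⟩
  · have hsum : ∑ k, (C k).size ≤ Fintype.card κ * (2 ^ d - 1) :=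
      Finset.sum_le_card_nsmul _ _ _ fun k _ => Nat.le_sub_one_of_lt (hsize k)
    have hpos : 0 < 2 ^ d := Nat.two_pow_pos d
    have := hsum.trans (Nat.mul_le_mul_right _ hκ)
    rw [Circuit.size_compose, pow_succ]
    omega
  · rw [Circuit.depth_compose, Finset.sup_lt_iff (Nat.succ_pos d)]
    exact fun k _ => Nat.succ_lt_succ (hdepth k)
  · exact (Circuit.eval_compose_out o C _).trans (GateOp.holds_congr fun k _ => hC k w)

theorem literal (i : Fin n) (a : α) : DecidedInLevels (d + 1) fun w => w i = a :=
  gate (κ := Empty) (Nat.zero_le 2) (.input (i, a)) (φ := nofun) nofun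

theorem const (P : Prop) : DecidedInLevels (n := n) (α := α) (d + 1) fun _ => P := by
  by_cases hP : P
  · exact (gate (κ := Empty) (Nat.zero_le 2) (.and ∅) (φ := nofun) nofun).congr fun w => by
      simp [GateOp.Holds, hP]
  · exact (gate (κ := Empty) (Nat.zero_le 2) (.or ∅) (φ := nofun) nofun).congr fun w => by
      simp [GateOp.Holds, hP]

theorem not (h : DecidedInLevels d φ) : DecidedInLevels (d + 1) fun w => ¬ φ w :=
  gate (κ := Unit) one_le_two (.not ()) fun _ => h

theorem and (hφ : DecidedInLevels d φ) (hψ : DecidedInLevels d ψ) :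
    DecidedInLevels (d + 1) fun w => φ w ∧ ψ w :=
  (gate (κ := Bool) le_rfl (.and Finset.univ) (φ := fun b => bif b then ψ else φ)
    (Bool.forall_bool.2 ⟨hφ, hψ⟩)).congr fun w => by simp [GateOp.Holds]

theorem or (hφ : DecidedInLevels d φ) (hψ : DecidedInLevels d ψ) :
    DecidedInLevels (d + 1) fun w => φ w ∨ ψ w :=
  (gate (κ := Bool) le_rfl (.or Finset.univ) (φ := fun b => bif b then ψ else φ)
    (Bool.forall_bool.2 ⟨hφ, hψ⟩)).congr fun w => by simp [GateOp.Holds]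

theorem exists_mem {β : Type} (s : Finset β) {φ : β → (Fin n → α) → Prop}
    (h : ∀ b, DecidedInLevels (d + 1) (φ b)) :
    DecidedInLevels (d + 1 + s.card) fun w => ∃ b ∈ s, φ b w := by
  induction s using Finset.cons_induction with
  | empty => exact (const False).congr fun w => by simp
  | cons b s hb ih =>
    rw [Finset.card_cons]
    exact ((h b).mono (Nat.le_add_right _ _) |>.or ih).congr fun w => by simp

end DecidedInLevels

/-! ### Word problems of finite monoids are in `NC¹` -/

/-- The word problem of the generators `π`: the words that evaluate to `1`. -/
def wordProblem {I M : Type} [Monoid M] (π : I → M) : Language I := {w | (w.map π).prod = 1}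

theorem mem_wordProblem {I M : Type} [Monoid M] {π : I → M} {w : List I} :
    w ∈ wordProblem π ↔ (w.map π).prod = 1 := Iff.rfl

theorem DecidedInLevels.list_prod_eq {n : ℕ} {α M : Type} [Fintype α] [Monoid M] [Fintype M]
    (f : α → M) (k : ℕ) (l : List (Fin n)) (hl : l.length ≤ 2 ^ k) (m : M) :
    DecidedInLevels ((Fintype.card (M × M) + 1) * k + (Fintype.card α + 1))
      fun w => (l.map fun i => f (w i)).prod = m := by
  classical
  induction k generalizing l m with
  | zero =>
    match l, hl with
    | [], _ => exact (const (1 = m)).congr fun w => by simp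
    | [i], _ =>
      have hcard := Finset.card_le_univ (Finset.univ.filter fun a => f a = m)
      exact ((exists_mem (d := 0) (Finset.univ.filter fun a => f a = m)
        fun a => literal i a).mono (by omega)).congr fun w => by simp
  | succ k ih =>
    rw [pow_succ] at hl
    have hcard := Finset.card_le_univ (Finset.univ.filter fun q : M × M => q.1 * q.2 = m)
    have hfirst := ih (l.take (2 ^ k)) (by simp)
    have hsecond := ih (l.drop (2 ^ k)) (by simp; omega)
    refine ((exists_mem (Finset.univ.filter fun q : M × M => q.1 * q.2 = m)
      fun q => (hfirst q.1).and (hsecond q.2)).mono (by rw [mul_add]; omega)).congr fun w => ?_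
    conv_rhs => rw [← List.take_append_drop (2 ^ k) l, List.map_append, List.prod_append]
    simp

theorem pow_add_self_mono (n : ℕ) : Monotone fun c => n ^ c + c := by
  refine monotone_nat_of_le_succ fun c => ?_
  rcases Nat.eq_zero_or_pos n with rfl | hn
  · rcases c with _ | c <;> simp
  · exact add_le_add (Nat.pow_le_pow_right hn c.le_succ) c.le_succ

theorem exists_two_pow_mul_log_add_le (a b : ℕ) : ∃ c : ℕ, ∀ n : ℕ,
    2 ^ (a * Nat.log 2 n + b) ≤ n ^ c + c := by
  refine ⟨a + 2 ^ b, fun n => ?_⟩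
  rcases Nat.lt_or_ge n 2 with hn | hn
  · rw [Nat.log_of_lt hn, mul_zero, zero_add]
    omega
  · calc 2 ^ (a * Nat.log 2 n + b) = (2 ^ Nat.log 2 n) ^ a * 2 ^ b := by
          rw [pow_add, mul_comm a, pow_mul]
      _ ≤ n ^ a * n ^ 2 ^ b :=
          Nat.mul_le_mul (Nat.pow_le_pow_left (Nat.pow_log_le_self 2 (by omega)) a)
            (Nat.lt_two_pow_self.le.trans (Nat.pow_le_pow_left hn _))
      _ = n ^ (a + 2 ^ b) := (pow_add _ _ _).symm
      _ ≤ n ^ (a + 2 ^ b) + (a + 2 ^ b) := Nat.le_add_right _ _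

theorem inNC1_wordProblem {I M : Type} [Finite I] [Monoid M] [Finite M] (π : I → M) :
    InNC1 (wordProblem π) := by
  have := Fintype.ofFinite I
  have := Fintype.ofFinite M
  set A := Fintype.card (M × M) + 1
  set B := Fintype.card I + 1
  obtain ⟨c, hc⟩ := exists_two_pow_mul_log_add_le A (A + B)
  refine ⟨c + A + B, fun n => ?_⟩
  have hn : (List.finRange n).length ≤ 2 ^ (Nat.log 2 n + 1) := by
    rw [List.length_finRange]
    exact (Nat.lt_pow_succ_log_self one_lt_two n).le
  have hlevels : A * (Nat.log 2 n + 1) + B = A * Nat.log 2 n + (A + B) := by ring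
  obtain ⟨C, hfan, hsize, hdepth, hC⟩ := DecidedInLevels.list_prod_eq π _ _ hn 1
  rw [hlevels] at hsize hdepth
  refine ⟨C, hfan, ?_, hdepth.le.trans ?_, fun w => (hC w).trans ?_⟩
  · exact hsize.le.trans ((hc n).trans (pow_add_self_mono n (by omega)))
  · gcongr <;> omega
  · rw [mem_wordProblem, List.ofFn_eq_map, List.map_map]
    rfl

/-! ### Barrington's theorem -/

/-- An instruction of a branching program over the generators `I`: a fixed generator, or the choice
between the generators `s` and `t` according to whether the letter in position `i` is `a`. -/
inductive Instruction (n : ℕ) (α I : Type) : Type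
  | const (s : I) : Instruction n α I
  | query (i : Fin n) (a : α) (s t : I) : Instruction n α I

namespace Instruction

variable {n : ℕ} {α I : Type}

open Classical in
/-- The generator that an instruction yields on the input `w`. -/
noncomputable def output (w : Fin n → α) : Instruction n α I → I
  | const s => s
  | query i a s t => if w i = a then s else t

theorem decidedInLevels_output_eq (c : Instruction n α I) (b : I) :
    DecidedInLevels 4 fun w => c.output w = b := by
  cases c with
  | const s => exact .const (s = b)
  | query i a s t =>
    have hs : DecidedInLevels 3 fun w : Fin n → α => w i = a ∧ s = b :=
      (DecidedInLevels.literal i a).and (.const (s = b))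
    have ht : DecidedInLevels 3 fun w : Fin n → α => ¬ w i = a ∧ t = b :=
      (DecidedInLevels.literal i a).not.and (.const (t = b))
    refine (hs.or ht).congr fun w => ?_
    by_cases hw : w i = a <;> simp [output, hw]

end Instruction

section Barrington

open scoped commutatorElement

variable {n : ℕ} {α I G : Type} [Group G] {π : I → G} {K : Set G} {m : ℕ}

/-- The group element that a branching program computes on the input `w`. -/
noncomputable def programValue (π : I → G) (P : List (Instruction n α I)) (w : Fin n → α) : G :=
  (P.map fun c => π (c.output w)).prod

theorem programValue_append (P Q : List (Instruction n α I)) (w : Fin n → α) :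
    programValue π (P ++ Q) w = programValue π P w * programValue π Q w := by
  rw [programValue, List.map_append, List.prod_append]
  rfl

variable (π K m) in
/-- The hypotheses on which Barrington's argument rests: `K` is closed under inverses, its elements
are commutators of elements of `K`, and its elements as well as `1` are words of length `m` in the
generators `π`. -/
structure IsBarrington : Prop where
  inv_mem : ∀ σ ∈ K, σ⁻¹ ∈ K
  exists_commutator_eq : ∀ σ ∈ K, ∃ a ∈ K, ∃ b ∈ K, ⁅a, b⁆ = σ
  exists_word_eq : ∀ σ ∈ K, ∃ l : List I, l.length = m ∧ (l.map π).prod = σ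
  exists_word_eq_one : ∃ l : List I, l.length = m ∧ (l.map π).prod = 1

open Classical in
variable (π K) in
/-- Each `σ ∈ K` has a branching program of length at most `N` that computes `σ` on the inputs with
the property `φ`, and `1` on the others. -/
def Programmable (N : ℕ) (φ : (Fin n → α) → Prop) : Prop :=
  ∀ σ ∈ K, ∃ P : List (Instruction n α I), P.length ≤ N ∧
    ∀ w, programValue π P w = if φ w then σ else 1

namespace Programmable

variable {N N' : ℕ} {φ ψ : (Fin n → α) → Prop}

theorem mono (h : Programmable π K N φ) (hN : N ≤ N') : Programmable π K N' φ := fun σ hσ =>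
  let ⟨P, hlen, hP⟩ := h σ hσ
  ⟨P, hlen.trans hN, hP⟩

theorem congr (h : Programmable π K N φ) (hφ : ∀ w, φ w ↔ ψ w) : Programmable π K N ψ :=
  funext (fun w => propext (hφ w)) ▸ h

theorem true (hK : IsBarrington π K m) :
    Programmable π K m fun _ : Fin n → α => True := fun σ hσ => by
  obtain ⟨l, hlen, hl⟩ := hK.exists_word_eq σ hσ
  refine ⟨l.map .const, (List.length_map _).trans_le hlen.le, fun w => ?_⟩
  rw [if_pos trivial, programValue, List.map_map]
  exact hl

theorem literal (hK : IsBarrington π K m) (i : Fin n) (a : α) :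
    Programmable π K m fun w => w i = a := fun σ hσ => by
  obtain ⟨l, hlen, hl⟩ := hK.exists_word_eq σ hσ
  obtain ⟨l', hlen', hl'⟩ := hK.exists_word_eq_one
  refine ⟨(l.zip l').map fun q => .query i a q.1 q.2, by simp [hlen, hlen'], fun w => ?_⟩
  have hfst : ((l.zip l').map (π ∘ Prod.fst)).prod = σ := by
    rw [← List.map_map, List.map_fst_zip (by omega), hl]
  have hsnd : ((l.zip l').map (π ∘ Prod.snd)).prod = 1 := by
    rw [← List.map_map, List.map_snd_zip (by omega), hl']
  rw [programValue, List.map_map]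
  split_ifs with hw
  · simpa [Function.comp_def, Instruction.output, hw] using hfst
  · simpa [Function.comp_def, Instruction.output, hw] using hsnd

theorem not (hK : IsBarrington π K m) (h : Programmable π K N φ) :
    Programmable π K (N + m) fun w => ¬ φ w := fun σ hσ => by
  obtain ⟨P, hlen, hP⟩ := h σ⁻¹ (hK.inv_mem σ hσ)
  obtain ⟨Q, hlen', hQ⟩ := true hK σ hσ
  refine ⟨P ++ Q, List.length_append.trans_le (add_le_add hlen hlen'), fun w => ?_⟩
  rw [programValue_append, hP, hQ]
  by_cases hw : φ w <;> simp [hw]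

/-- If `⁅a, b⁆ = σ`, then the four programs for `a`, `b`, `a⁻¹`, `b⁻¹`, one after the other, compute
`1` as soon as one of the conditions fails. -/
theorem and (hK : IsBarrington π K m) (hφ : Programmable π K N φ) (hψ : Programmable π K N ψ) :
    Programmable π K (4 * N) fun w => φ w ∧ ψ w := fun σ hσ => by
  obtain ⟨a, ha, b, hb, rfl⟩ := hK.exists_commutator_eq σ hσ
  obtain ⟨P, hlenP, hP⟩ := hφ a ha
  obtain ⟨Q, hlenQ, hQ⟩ := hψ b hb
  obtain ⟨P', hlenP', hP'⟩ := hφ a⁻¹ (hK.inv_mem a ha)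
  obtain ⟨Q', hlenQ', hQ'⟩ := hψ b⁻¹ (hK.inv_mem b hb)
  refine ⟨P ++ Q ++ P' ++ Q', by simp only [List.length_append]; omega, fun w => ?_⟩
  simp only [programValue_append, hP, hQ, hP', hQ', commutatorElement_def]
  by_cases hw : φ w <;> by_cases hw' : ψ w <;> simp [hw, hw']

theorem forall_mem (hK : IsBarrington π K m) (hN : m ≤ N) {β : Type} (s : Finset β)
    {φ : β → (Fin n → α) → Prop} (h : ∀ b ∈ s, Programmable π K N (φ b)) :
    Programmable π K (4 ^ s.card * N) fun w => ∀ b ∈ s, φ b w := by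
  induction s using Finset.cons_induction with
  | empty => exact ((true hK).mono (by simpa)).congr fun w => by simp
  | cons b s hb ih =>
    have hfirst : Programmable π K (4 ^ s.card * N) (φ b) :=
      (h b (Finset.mem_cons_self b s)).mono (Nat.le_mul_of_pos_left N (by positivity))
    have hrest := ih fun b' hb' => h b' (Finset.mem_cons_of_mem hb')
    rw [Finset.card_cons, pow_succ', mul_assoc]
    exact (and hK hfirst hrest).congr fun w => by simp

theorem exists_mem (hK : IsBarrington π K m) {β : Type} (s : Finset β)
    {φ : β → (Fin n → α) → Prop} (h : ∀ b ∈ s, Programmable π K N (φ b)) :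
    Programmable π K (4 ^ s.card * (N + m) + m) fun w => ∃ b ∈ s, φ b w :=
  (not hK (forall_mem hK (Nat.le_add_left m N) s fun b hb => not hK (h b hb))).congr
    fun w => by push Not; rfl

end Programmable

theorem Circuit.FanInTwo.programmable_eval (hK : IsBarrington π K m) {C : Circuit (Fin n × α)}
    (hC : C.FanInTwo) (g : C.Gate) :
    Programmable π K (m * 64 ^ (C.level g + 1)) fun w => C.eval (fun q => w q.1 = q.2) g := by
  induction hl : C.level g using Nat.strong_induction_on generalizing g with
  | _ l ih =>
    subst hl
    set N := m * 64 ^ C.level g with hN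
    have hm : m ≤ N := Nat.le_mul_of_pos_right m (by positivity)
    have hchild : ∀ g' ∈ (C.op g).children,
        Programmable π K N fun w : Fin n → α => C.eval (fun q => w q.1 = q.2) g' := fun g' hg' =>
      (ih _ (C.level_lt g g' hg') g' rfl).mono
        (Nat.mul_le_mul_left m (Nat.pow_le_pow_right (by norm_num) (C.level_lt g g' hg')))
    have hpow : 4 ^ (C.op g).children.card ≤ 4 ^ 2 := Nat.pow_le_pow_right (by norm_num) (hC g)
    rw [pow_succ, ← mul_assoc, ← hN]
    simp only [C.eval_iff_holds _ g]
    cases h : C.op g <;> rw [h] at hchild hpow <;>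
      simp only [GateOp.Holds, GateOp.children] at hchild hpow ⊢
    case input i => exact (Programmable.literal hK i.1 i.2).mono (by omega)
    case not g' =>
      exact (Programmable.not hK (hchild g' (Finset.mem_singleton_self g'))).mono (by omega)
    case and S => exact (Programmable.forall_mem hK hm S hchild).mono (by nlinarith)
    case or S => exact (Programmable.exists_mem hK S hchild).mono (by nlinarith)

theorem IsBarrington.ac0Reducible (hK : IsBarrington π K m) {σ : G} (hσ : σ ∈ K) (hσ1 : σ ≠ 1)
    {L : Language α} (hL : InNC1 L) : AC0Reducible L (wordProblem π) := by
  obtain ⟨c, hc⟩ := hL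
  obtain ⟨e, he⟩ := exists_two_pow_mul_log_add_le (6 * c) (6 * c + 12 + m)
  refine ⟨e + 16, fun n => ?_⟩
  obtain ⟨C, hfan, -, hdepth, hC⟩ := hc n
  obtain ⟨P, hlen, hP⟩ := (Programmable.not hK (hfan.programmable_eval hK C.out)) σ hσ
  refine ⟨P.length, ?_, fun w j => P[j].output w, fun w => ?_, fun j b => ?_⟩
  · calc P.length ≤ m * 64 ^ (C.depth + 1) + m := hlen
      _ ≤ m * 64 ^ (C.depth + 2) := by
          have : 0 < 64 ^ (C.depth + 1) := by positivity
          rw [pow_succ 64 (C.depth + 1)]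
          nlinarith
      _ ≤ 2 ^ m * 64 ^ (C.depth + 2) := Nat.mul_le_mul_right _ Nat.lt_two_pow_self.le
      _ = 2 ^ (m + 6 * (C.depth + 2)) := by rw [pow_add 2 m, pow_mul]; norm_num
      _ ≤ 2 ^ (6 * c * Nat.log 2 n + (6 * c + 12 + m)) :=
          Nat.pow_le_pow_right two_pos (by rw [mul_assoc]; omega)
      _ ≤ n ^ (e + 16) + (e + 16) := (he n).trans (pow_add_self_mono n (Nat.le_add_right e 16))
  · have hvalue : ((List.ofFn fun j : Fin P.length => P[j].output w).map π).prod =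
        programValue π P w := by
      rw [programValue, List.map_ofFn]
      conv_rhs => rw [← List.ofFn_getElem (xs := P), List.map_ofFn]
      rfl
    rw [mem_wordProblem, hvalue, hP w, ← hC w]
    simp [Circuit.Accepts, hσ1]
  · obtain ⟨C', -, hsize, hdepth, hC'⟩ := P[j].decidedInLevels_output_eq b
    exact ⟨C', by omega, by omega, hC'⟩

theorem isBarrington_conjugatesOf {c : G} {l l' : List I} (hinv : IsConj c c⁻¹)
    (hcomm : ∃ ρ ρ' : G, ⁅ρ * c * ρ⁻¹, ρ' * c * ρ'⁻¹⁆ = c)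
    (hconj : ∀ (τ : G) (s : I), ∃ t, π t = MulAut.conj τ (π s)) (hl : (l.map π).prod = c)
    (hl' : (l'.map π).prod = 1) (hlen : l'.length = l.length) :
    IsBarrington π (conjugatesOf c) l.length where
  inv_mem σ hσ := by
    obtain ⟨τ, rfl⟩ := isConj_iff.1 hσ
    exact hinv.trans (isConj_iff.2 ⟨τ, conj_inv.symm⟩)
  exists_commutator_eq σ hσ := by
    obtain ⟨τ, rfl⟩ := isConj_iff.1 hσ
    obtain ⟨ρ, ρ', hρ⟩ := hcomm
    refine ⟨τ * (ρ * c * ρ⁻¹) * τ⁻¹, isConj_iff.2 ⟨τ * ρ, by group⟩,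
      τ * (ρ' * c * ρ'⁻¹) * τ⁻¹, isConj_iff.2 ⟨τ * ρ', by group⟩, ?_⟩
    rw [← conjugate_commutatorElement, hρ]
  exists_word_eq σ hσ := by
    obtain ⟨τ, rfl⟩ := isConj_iff.1 hσ
    choose f hf using hconj τ
    refine ⟨l.map f, List.length_map f, ?_⟩
    rw [← hl, ← MulAut.conj_apply, map_list_prod, List.map_map, List.map_map]
    exact congrArg List.prod (List.map_congr_left fun s _ => hf s)
  exists_word_eq_one := ⟨l', hlen, hl'⟩

end Barrington

/-! ### Five-cycles -/

/-- The instruction `[i ↔ i + 1]`. -/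
def adjacentSwap (i : Fin 5) : Swap := ⟨(i, i + 1), by decide +revert⟩

/-- A `5`-cycle, given by a word of length four in the swaps. -/
def fiveCycle : Equiv.Perm (Fin 5) := (([0, 1, 2, 3].map adjacentSwap).map Swap.perm).prod

theorem exists_perm_eq_conj (τ : Equiv.Perm (Fin 5)) (s : Swap) :
    ∃ t : Swap, t.perm = MulAut.conj τ s.perm :=
  ⟨⟨(τ s.1.1, τ s.1.2), τ.injective.ne s.2⟩, Equiv.swap_apply_apply τ _ _⟩

set_option maxRecDepth 10000 in
theorem isBarrington_swap : IsBarrington Swap.perm (conjugatesOf fiveCycle) 4 :=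
  isBarrington_conjugatesOf (l' := List.replicate 4 (adjacentSwap 0))
    (isConj_iff.2 ⟨Equiv.swap 0 4 * Equiv.swap 1 3, by decide⟩)
    ⟨Equiv.swap 0 1 * Equiv.swap 0 3, Equiv.swap 0 1 * Equiv.swap 1 4, Equiv.ext (by decide)⟩
    exists_perm_eq_conj rfl (by decide) rfl

theorem inNC1_swapIdentity : InNC1 swapIdentity := inNC1_wordProblem Swap.perm

theorem ac0Reducible_swapIdentity {α : Type} {L : Language α} (hL : InNC1 L) :
    AC0Reducible L swapIdentity :=
  isBarrington_swap.ac0Reducible mem_conjugatesOf_self (by decide) hL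

/-! ### Floating-point numbers and roundings -/

section Rounding

variable {p : ℕ} {r : ℝ → ℝ}

theorem intCast_mem_floats {m : ℤ} (hm : |m| < 2 ^ p) : (m : ℝ) ∈ floats p :=
  ⟨m, 0, hm, by simp, by simp⟩

theorem zero_mem_floats : (0 : ℝ) ∈ floats p := by
  simpa using intCast_mem_floats (p := p) (m := 0) (by simp)

theorem neg_mem_floats {x : ℝ} (hx : x ∈ floats p) : -x ∈ floats p := by
  obtain ⟨m, e, hm, he, rfl⟩ := hx
  exact ⟨-m, e, by rwa [abs_neg], he, by push_cast; ring⟩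

theorem zpow_mem_floats (hp : 1 ≤ p) {e : ℤ} (he : |e| < 2 ^ p) : (2 : ℝ) ^ e ∈ floats p :=
  ⟨1, e, by simpa using one_lt_pow₀ (one_lt_two (α := ℤ)) (by omega), he, by simp⟩

theorem one_mem_floats (hp : 1 ≤ p) : (1 : ℝ) ∈ floats p := by
  simpa using zpow_mem_floats hp (e := 0) (by simp)

theorem pow_mem_floats (hp : 1 ≤ p) {k : ℕ} (hk : k < 2 ^ p) : (2 : ℝ) ^ k ∈ floats p := by
  simpa using zpow_mem_floats hp (e := k) (by rw [Nat.abs_cast]; exact_mod_cast hk)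

theorem inv_pow_mem_floats (hp : 1 ≤ p) {k : ℕ} (hk : k < 2 ^ p) :
    ((2 : ℝ) ^ k)⁻¹ ∈ floats p := by
  simpa using zpow_mem_floats hp (e := -k) (by rw [abs_neg, Nat.abs_cast]; exact_mod_cast hk)

namespace IsRounding

theorem map_le (hr : IsRounding p r) {x y : ℝ} (hy : y ∈ floats p) (h : x ≤ y) : r x ≤ y :=
  (hr.monotone h).trans_eq (hr.exact y hy)

theorem le_map (hr : IsRounding p r) {x y : ℝ} (hy : y ∈ floats p) (h : y ≤ x) : y ≤ r x :=
  (hr.exact y hy).symm.trans_le (hr.monotone h)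

theorem map_zero (hr : IsRounding p r) : r 0 = 0 := hr.exact 0 zero_mem_floats

theorem map_one (hr : IsRounding p r) (hp : 1 ≤ p) : r 1 = 1 := hr.exact 1 (one_mem_floats hp)

theorem map_map (hr : IsRounding p r) (x : ℝ) : r (r x) = r x := hr.exact _ (hr.mem x)

theorem abs_map_sub_le (hr : IsRounding p r) {e : ℤ} (he : |e| < 2 ^ p) {x : ℝ}
    (hx : |x| ≤ (2 ^ p - 1) * 2 ^ e) : |r x - x| ≤ 2 ^ e := by
  have hg : (0 : ℝ) < 2 ^ e := by positivity
  obtain ⟨y, rfl⟩ : ∃ y, x = y * 2 ^ e := ⟨x / 2 ^ e, (div_mul_cancel₀ x hg.ne').symm⟩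
  rw [abs_mul, abs_of_pos hg, mul_le_mul_iff_left₀ hg, abs_le] at hx
  have hceil : |⌈y⌉| < 2 ^ p := by
    have hle : ⌈y⌉ ≤ 2 ^ p - 1 := Int.ceil_le.2 (by push_cast; exact hx.2)
    have hge : -(2 ^ p - 1) ≤ ⌈y⌉ := by
      exact_mod_cast (Int.cast_le (R := ℝ)).1 (by push_cast; exact hx.1.trans (Int.le_ceil y))
    exact abs_lt.2 ⟨by linarith, by linarith⟩
  have hfloor : |⌊y⌋| < 2 ^ p := by
    have hge : -(2 ^ p - 1) ≤ ⌊y⌋ := Int.le_floor.2 (by push_cast; exact hx.1)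
    have hle : ⌊y⌋ ≤ 2 ^ p - 1 := by
      exact_mod_cast (Int.cast_le (R := ℝ)).1 (by push_cast; exact (Int.floor_le y).trans hx.2)
    exact abs_lt.2 ⟨by linarith, by linarith⟩
  have hupper : r (y * 2 ^ e) ≤ ⌈y⌉ * 2 ^ e :=
    hr.map_le ⟨_, e, hceil, he, rfl⟩ (mul_le_mul_of_nonneg_right (Int.le_ceil y) hg.le)
  have hlower : ⌊y⌋ * 2 ^ e ≤ r (y * 2 ^ e) :=
    hr.le_map ⟨_, e, hfloor, he, rfl⟩ (mul_le_mul_of_nonneg_right (Int.floor_le y) hg.le)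
  have := mul_le_mul_of_nonneg_right (Int.ceil_lt_add_one y).le hg.le
  have := mul_le_mul_of_nonneg_right (Int.sub_one_lt_floor y).le hg.le
  exact abs_le.2 ⟨by linarith, by linarith⟩

theorem map_le_two_mul (hr : IsRounding p r) {k : ℕ} (hk : k + 1 < 2 ^ p) {y : ℝ} (hy : 1 ≤ y)
    (hyk : y ≤ 2 ^ k) : r y ≤ 2 * y := by
  have hp : 1 ≤ p := Nat.one_le_iff_ne_zero.2 (by rintro rfl; simp at hk)
  obtain ⟨j, hjy, hyj⟩ := exists_nat_pow_near hy one_lt_two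
  have hjk : j ≤ k := (pow_le_pow_iff_right₀ (one_lt_two (α := ℝ))).1 (hjy.trans hyk)
  calc r y ≤ 2 ^ (j + 1) := hr.map_le (pow_mem_floats hp (by omega)) hyj.le
    _ = 2 * 2 ^ j := pow_succ' 2 j
    _ ≤ 2 * y := by gcongr

theorem one_le_map_add (hr : IsRounding p r) (hp : 1 ≤ p) {x y : ℝ} (hx : 0 ≤ x) (hy : 1 ≤ y) :
    1 ≤ r (x + y) :=
  hr.le_map (one_mem_floats hp) (by linarith)

theorem inv_four_le_map_div (hr : IsRounding p r) {k : ℕ} (hk : k + 2 < 2 ^ p) {x y : ℝ}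
    (hy : 0 ≤ y) (hyx : y ≤ x) (hx : 1 ≤ x) (hxk : x ≤ 2 ^ k) :
    (2 ^ 2)⁻¹ ≤ r (x / r (y + x)) := by
  have hp : 1 ≤ p := Nat.one_le_iff_ne_zero.2 (by rintro rfl; simp at hk)
  have hpos := hr.one_le_map_add hp hy hx
  have hupper : r (y + x) ≤ 2 * (y + x) :=
    hr.map_le_two_mul (k := k + 1) (by omega) (by linarith) (by rw [pow_succ]; linarith)
  refine hr.le_map (inv_pow_mem_floats hp (by omega)) ?_
  rw [le_div_iff₀ (by linarith)]
  linarith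

theorem map_div_le (hr : IsRounding p r) (hp : 1 ≤ p) {x y c : ℝ} (hc : c ∈ floats p)
    (hx : 0 ≤ x) (hxc : x ≤ c) (hy : 1 ≤ y) : r (x / r (y + x)) ≤ c := by
  have hpos : 1 ≤ r (y + x) := add_comm x y ▸ hr.one_le_map_add hp hx hy
  exact hr.map_le hc ((div_le_self hx hpos).trans hxc)

end IsRounding

end Rounding

/-! ### Inequalities -/

section Inequalities

open Matrix

theorem sum_mul_perm_lt_sum_mul_self {ι R : Type*} [Fintype ι] [CommRing R] [LinearOrder R]
    [IsStrictOrderedRing R] {f : ι → R} (hf : Function.Injective f) {σ : Equiv.Perm ι}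
    (hσ : σ ≠ 1) : ∑ a, f (σ a) * f a < ∑ a, f a * f a := by
  obtain ⟨a, ha⟩ : ∃ a, σ a ≠ a := by
    by_contra! h
    exact hσ (Equiv.ext h)
  have hpos : 0 < ∑ a, (f (σ a) - f a) ^ 2 :=
    Finset.sum_pos' (fun _ _ => sq_nonneg _)
      ⟨a, Finset.mem_univ a, sq_pos_of_ne_zero (sub_ne_zero.2 (hf.ne ha))⟩
  have hperm : ∑ a, f (σ a) * f (σ a) = ∑ a, f a * f a := Equiv.sum_comp σ fun a => f a * f a
  have hexpand : ∑ a, (f (σ a) - f a) ^ 2 =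
      ∑ a, f (σ a) * f (σ a) + ∑ a, f a * f a - 2 * ∑ a, f (σ a) * f a := by
    rw [Finset.mul_sum, ← Finset.sum_add_distrib, ← Finset.sum_sub_distrib]
    exact Finset.sum_congr rfl fun a _ => by ring
  linarith

theorem two_pow_le_exp (k : ℕ) : (2 : ℝ) ^ k ≤ Real.exp k := by
  rw [← Real.exp_one_pow]
  gcongr
  linarith [Real.exp_one_gt_d9]

theorem exp_le_two_pow (k : ℕ) : Real.exp k ≤ 2 ^ (2 * k) := by
  rw [← Real.exp_one_pow, pow_mul]
  gcongr
  linarith [Real.exp_one_lt_d9]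

theorem one_sub_sigmoid_natCast_le (k : ℕ) : 1 - Real.sigmoid k ≤ (2 ^ k)⁻¹ := by
  rw [← Real.sigmoid_neg, Real.sigmoid_def, neg_neg]
  gcongr
  linarith [two_pow_le_exp k]

theorem abs_mul_mul_sub_le {β w w' z z' ε : ℝ} (hε : ε ≤ 1) (hβ : |β - 2| ≤ 2 * ε)
    (hw : |w - z| ≤ ε) (hw' : |w' - z'| ≤ ε) (hz : |z| ≤ 1) (hz' : |z'| ≤ 1) :
    |β * w * w' - 2 * z * z'| ≤ 14 * ε := by
  have hε0 : 0 ≤ ε := (abs_nonneg _).trans hw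
  have hw2 : |w| ≤ 2 := by linarith [abs_sub_abs_le_abs_sub w z]
  have hw2' : |w'| ≤ 2 := by linarith [abs_sub_abs_le_abs_sub w' z']
  calc |β * w * w' - 2 * z * z'|
      = |(β - 2) * w * w' + (2 * (w - z) * w' + 2 * z * (w' - z'))| := by ring_nf
    _ ≤ |(β - 2) * w * w'| + (|2 * (w - z) * w'| + |2 * z * (w' - z')|) :=
        (abs_add_le _ _).trans (add_le_add_right (abs_add_le _ _) _)
    _ = |β - 2| * |w| * |w'| + (2 * |w - z| * |w'| + 2 * |z| * |w' - z'|) := by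
        simp only [abs_mul, abs_two]
    _ ≤ 2 * ε * 2 * 2 + (2 * ε * 2 + 2 * 1 * ε) := by gcongr
    _ = 14 * ε := by ring

theorem abs_dotProduct_sub_le {ι : Type*} [Fintype ι] {v z : ι → ℝ} {ε : ℝ}
    (h : ∀ a, |v a - z a| ≤ ε) (q : ι → ℝ) : |v ⬝ᵥ q - z ⬝ᵥ q| ≤ ε * ∑ a, |q a| := by
  rw [← sub_dotProduct, Finset.mul_sum]
  refine (Finset.abs_sum_le_sum_abs _ _).trans (Finset.sum_le_sum fun a _ => ?_)
  rw [abs_mul]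
  exact mul_le_mul_of_nonneg_right (h a) (abs_nonneg _)

theorem abs_vecMul_sub_perm_le {ι : Type*} [Fintype ι] [DecidableEq ι] {H : Matrix ι ι ℝ}
    {σ : Equiv.Perm ι} {δ M : ℝ} (hH : ∀ a c, |H a c - if a = σ c then 1 else 0| ≤ δ)
    {v : ι → ℝ} (hv : ∀ a, |v a| ≤ M) (c : ι) :
    |(v ᵥ* H) c - v (σ c)| ≤ Fintype.card ι * (M * δ) := by
  have h : (v ᵥ* H) c - v (σ c) = ∑ a, v a * (H a c - if a = σ c then 1 else 0) := by
    simp [vecMul, dotProduct, mul_sub, Finset.sum_sub_distrib]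
  rw [h, ← nsmul_eq_mul]
  refine (Finset.abs_sum_le_sum_abs _ _).trans (Finset.sum_le_card_nsmul _ _ _ fun a _ => ?_)
  rw [abs_mul]
  exact mul_le_mul (hv a) (hH a c) (abs_nonneg _) ((abs_nonneg _).trans (hv a))

theorem Head.abs_carry_sub_le {D d : ℕ} (P : Head D d) {r : ℝ → ℝ} {X : ℕ → Fin D → ℝ}
    {l : List (Equiv.Perm (Fin d))} {z : Fin d → ℝ} {M δ ε : ℝ} (hkey : P.key r (X 0) = z)
    (hz : ∀ a, |z a| ≤ M) (hround : ∀ x, |x| ≤ M + 1 → |r x - x| ≤ ε)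
    (hH : ∀ t (ht : t < l.length) a c,
      |P.transition r (X (t + 1)) a c - if a = l[t] c then 1 else 0| ≤ δ)
    (hstep : l.length * (d * ((M + 1) * δ) + ε) ≤ 1) {t : ℕ} (ht : t ≤ l.length) (a : Fin d) :
    |P.carry r X 0 t a - z ((l.take t).prod a)| ≤ t * (d * ((M + 1) * δ) + ε) := by
  set η := d * ((M + 1) * δ) + ε
  induction t generalizing a with
  | zero => simp [Head.carry, hkey]
  | succ t ih =>
    have hM : 0 ≤ M := (abs_nonneg _).trans (hz a)
    have hδ : 0 ≤ δ := (abs_nonneg _).trans (hH t ht a a)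
    have hε : 0 ≤ ε := (abs_nonneg _).trans (hround 0 (by rw [abs_zero]; linarith))
    have hsmall : (t + 1 : ℝ) * η ≤ 1 := by
      refine le_trans ?_ hstep
      gcongr
      exact_mod_cast ht
    have hprev : ∀ a, |P.carry r X 0 t a - z ((l.take t).prod a)| ≤ t * η :=
      ih (Nat.le_of_succ_le ht)
    have hcarry : ∀ a, |P.carry r X 0 t a| ≤ M + t * η := fun a => by
      linarith [hprev a, hz ((l.take t).prod a),
        abs_sub_abs_le_abs_sub (P.carry r X 0 t a) (z ((l.take t).prod a))]
    have hη0 : 0 ≤ η := by positivity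
    have hmul := abs_vecMul_sub_perm_le (hH t ht) (M := M + 1)
      (fun a => (hcarry a).trans (by linarith)) a
    rw [Fintype.card_fin] at hmul
    set y := (P.carry r X 0 t ᵥ* P.transition r (X (t + 1))) a
    have hy : |r y - y| ≤ ε := hround y (by
      linarith [hcarry (l[t] a), abs_sub_abs_le_abs_sub y (P.carry r X 0 t (l[t] a))])
    have hsucc : P.carry r X 0 (t + 1) a = r y := by rw [Head.carry, zero_add]; rfl
    rw [hsucc, List.take_succ_eq_append_getElem ht, List.prod_append, List.prod_singleton,
      Equiv.Perm.mul_apply, Nat.cast_succ]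
    have := hprev (l[t] a)
    rw [abs_le] at *
    constructor <;> linarith

end Inequalities

/-! ### The transformer -/

section Transformer

open Matrix

theorem of_append_mulVec_append {m n l : ℕ} {R : Type*} [NonUnitalNonAssocSemiring R]
    (u : Fin l → Fin m → R) (x : Fin l → Fin n → R) (v : Fin m → R) (y : Fin n → R) :
    Matrix.of (fun a => Fin.append (u a) (x a)) *ᵥ Fin.append v y =
      fun a => u a ⬝ᵥ v + x a ⬝ᵥ y := by
  ext
  simp [mulVec, dotProduct, Fin.sum_univ_add]

theorem append_mem {m n : ℕ} {α : Type*} {S : Set α} {u : Fin m → α} {x : Fin n → α}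
    (hu : ∀ a, u a ∈ S) (hx : ∀ a, x a ∈ S) (c : Fin (m + n)) : Fin.append u x c ∈ S := by
  induction c using Fin.addCases with
  | left a => simpa using hu a
  | right a => simpa using hx a

theorem one_sub_mul_single_sub_single {ι R : Type*} [DecidableEq ι] [Ring R] {x y : ι}
    (hxy : x ≠ y) (a c : ι) :
    (1 : Matrix ι ι R) a c -
        (Pi.single x 1 - Pi.single y 1 : ι → R) a * (Pi.single x 1 - Pi.single y 1 : ι → R) c =
      if a = Equiv.swap x y c then 1 else 0 := by
  simp only [one_apply, Equiv.swap_apply_def, Pi.sub_apply, Pi.single_apply]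
  by_cases hax : a = x <;> by_cases hay : a = y <;> by_cases hcx : c = x <;>
    by_cases hcy : c = y <;> by_cases hac : a = c <;> simp_all [eq_comm]

/-- The vector `e_x - e_y` of the swap `[x ↔ y]`; the reflection in its orthogonal complement
permutes the standard basis by the swap. -/
def Swap.direction (s : Swap) : Fin 5 → ℝ := Pi.single s.1.1 1 - Pi.single s.1.2 1

theorem Swap.direction_apply_mem (s : Swap) (a : Fin 5) : s.direction a ∈ ({0, 1, -1} : Set ℝ) := by
  obtain ⟨⟨x, y⟩, hxy⟩ := s
  by_cases hx : a = x <;> by_cases hy : a = y <;> simp_all [direction]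

theorem Swap.direction_dotProduct_self (s : Swap) : s.direction ⬝ᵥ s.direction = 2 := by
  simp [direction, s.2, s.2.symm]
  norm_num

/-- The logarithmic scale of the logits. -/
def logScale (n : ℕ) : ℕ := Nat.log 2 n + 5

/-- The precision used for sequences of length at most `n`. -/
def precision (n : ℕ) : ℕ := Nat.log 2 n + 41

/-- The key of the start token, whose entries are the labels of the five elements. -/
def startKey (a : Fin 5) : ℤ := a + 1

/-- The query vector of all tokens. As `∑ a, startKey a ^ 2 = 55` and `∑ a, startKey a = 15`, its
inner product with the start key permuted by `σ` is `15 * logScale n` if `σ = 1`, and at most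
`-15 * logScale n` otherwise. -/
def queryVec (n : ℕ) (a : Fin 5) : ℤ := logScale n * (30 * startKey a - 109)

/-- The token embedding: the direction of the swap, a coordinate that marks the start token, and a
constant coordinate. -/
def tokenEmb : Token → Fin (5 + 2) → ℝ
  | .start => Fin.append 0 ![1, 1]
  | .swap s => Fin.append s.direction ![0, 1]

/-- The attention head that tracks the product of the swaps. Its `β = 2 sigmoid (precision n)` is
so close to `2` that the transition matrices are almost permutation matrices. -/
def swapHead (n : ℕ) : Head (5 + 2) 5 where
  Wq := Matrix.of fun a => Fin.append 0 ![0, (queryVec n a : ℝ)]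
  Wk := Matrix.of fun a => Fin.append 0 ![(startKey a : ℝ), 0]
  Wv := Matrix.of fun _ => Fin.append 0 ![1, 0]
  Ww := Matrix.of fun a => Fin.append (Pi.single a 1) 0
  u := 0
  b := precision n

/-- The transformer with `h` heads that decides whether at most `n` swaps compose to the identity.
Only head `0` is used, and the threshold for its attention weight on the start token is `1 / 8`. -/
noncomputable def swapTransformer (h : ℕ) [NeZero h] (n : ℕ) : OneLayer Token h (5 + 2) 5 1 where
  emb := tokenEmb
  head := fun _ => swapHead n
  Wo := Matrix.single 0 (0, 0) 1
  W₁ := Matrix.single 0 0 1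
  b₁ := fun _ => -(2 ^ 3)⁻¹
  W₂ := 1
  b₂ := 0

theorem isBigO_precision :
    (fun n : ℕ => (precision n : ℝ)) =O[Filter.atTop] fun n : ℕ => Real.log (n : ℝ) := by
  refine Asymptotics.IsBigO.of_bound 43 ?_
  filter_upwards [Filter.eventually_ge_atTop 3] with n hn
  have hlog : 1 ≤ Real.log n := by
    rw [Real.le_log_iff_exp_le (by positivity)]
    exact Real.exp_one_lt_three.le.trans (by exact_mod_cast hn)
  have hlog2 : (Nat.log 2 n : ℝ) ≤ 2 * Real.log n :=
    calc (Nat.log 2 n : ℝ) ≤ Real.log n / Real.log 2 := by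
          simpa [Real.logb] using Real.natLog_le_logb n 2
      _ ≤ 2 * Real.log n := by
          rw [div_le_iff₀ (by positivity)]
          nlinarith [Real.log_two_gt_d9]
  rw [Real.norm_of_nonneg (by positivity), Real.norm_of_nonneg (by linarith), precision]
  push_cast
  linarith

theorem two_pow_precision (n : ℕ) : 2 ^ precision n = 2 ^ 41 * 2 ^ Nat.log 2 n := by
  rw [precision, pow_add, mul_comm]

theorem one_le_precision (n : ℕ) : 1 ≤ precision n := by simp [precision]

theorem five_le_logScale (n : ℕ) : 5 ≤ logScale n := by simp [logScale]

theorem mul_logScale_lt_two_pow_precision (n : ℕ) : 1000 * logScale n < 2 ^ precision n := by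
  have : Nat.log 2 n < 2 ^ Nat.log 2 n := Nat.lt_two_pow_self
  rw [two_pow_precision, logScale]
  lia

theorem mul_lt_two_pow_precision (n : ℕ) : 1000000000 * n < 2 ^ precision n := by
  have := Nat.lt_pow_succ_log_self one_lt_two n
  rw [pow_succ] at this
  rw [two_pow_precision]
  lia

theorem le_two_pow_logScale (n : ℕ) : n ≤ 2 ^ logScale n :=
  (Nat.lt_pow_succ_log_self one_lt_two n).le.trans
    (Nat.pow_le_pow_right two_pos (by rw [logScale]; lia))

theorem lt_two_pow_precision_of_le (n : ℕ) {k : ℕ} (hk : k ≤ 1000) : k < 2 ^ precision n := by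
  have := mul_logScale_lt_two_pow_precision n
  have := five_le_logScale n
  lia

theorem inv_pow_mem_floats_of_le (n : ℕ) {k : ℕ} (hk : k ≤ 1000) :
    ((2 : ℝ) ^ k)⁻¹ ∈ floats (precision n) :=
  inv_pow_mem_floats (one_le_precision n) (lt_two_pow_precision_of_le n hk)

theorem mul_logScale_mem_floats (n : ℕ) {m : ℤ} (hm : |m| ≤ 1000) :
    (m : ℝ) * logScale n ∈ floats (precision n) := by
  have hlt : |m * logScale n| < 2 ^ precision n := by
    rw [abs_mul, Nat.abs_cast]
    exact (mul_le_mul_of_nonneg_right hm (Nat.cast_nonneg _)).trans_lt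
      (by exact_mod_cast mul_logScale_lt_two_pow_precision n)
  simpa using intCast_mem_floats hlt

theorem queryVec_mem_floats (n : ℕ) (a : Fin 5) : (queryVec n a : ℝ) ∈ floats (precision n) := by
  have hle : |30 * startKey a - 109| ≤ 1000 := by revert a; decide
  simpa [queryVec, mul_comm] using mul_logScale_mem_floats n hle

theorem startKey_mem_floats (n : ℕ) (a : Fin 5) : (startKey a : ℝ) ∈ floats (precision n) := by
  have hle : |startKey a| ≤ (5 : ℕ) := by revert a; decide
  exact intCast_mem_floats
    (hle.trans_lt (by exact_mod_cast lt_two_pow_precision_of_le n (by norm_num)))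

theorem direction_mem_floats (n : ℕ) (s : Swap) (a : Fin 5) :
    s.direction a ∈ floats (precision n) := by
  have h1 := one_mem_floats (one_le_precision n)
  rcases s.direction_apply_mem a with h | h | h <;> rw [h]
  exacts [zero_mem_floats, h1, neg_mem_floats h1]

theorem tokenEmb_mem_floats (n : ℕ) (v : Token) (c : Fin (5 + 2)) :
    tokenEmb v c ∈ floats (precision n) := by
  have h0 := zero_mem_floats (p := precision n)
  have h1 := one_mem_floats (one_le_precision n)
  cases v with
  | start => exact append_mem (fun _ => h0) (by simp [Fin.forall_fin_two, h1]) c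
  | swap s => exact append_mem (direction_mem_floats n s) (by simp [Fin.forall_fin_two, h0, h1]) c

theorem swapHead_representable (n : ℕ) : (swapHead n).Representable (precision n) := by
  have h0 := zero_mem_floats (p := precision n)
  have h1 := one_mem_floats (one_le_precision n)
  have hb : (precision n : ℝ) ∈ floats (precision n) := by
    exact_mod_cast intCast_mem_floats (m := precision n)
      (by rw [Nat.abs_cast]; exact_mod_cast Nat.lt_two_pow_self)
  refine ⟨fun a => ?_, fun a => ?_, fun _ => ?_, fun a => ?_, fun _ => h0, hb⟩
  · exact append_mem (fun _ => h0) (by simp [Fin.forall_fin_two, h0, queryVec_mem_floats])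
  · exact append_mem (fun _ => h0) (by simp [Fin.forall_fin_two, h0, startKey_mem_floats])
  · exact append_mem (fun _ => h0) (by simp [Fin.forall_fin_two, h0, h1])
  · exact append_mem (fun c => by rw [Pi.single_apply]; split_ifs <;> assumption) fun _ => h0

theorem swapTransformer_representable (h : ℕ) [NeZero h] (n : ℕ) :
    (swapTransformer h n).Representable (precision n) := by
  have h0 := zero_mem_floats (p := precision n)
  have h1 := one_mem_floats (one_le_precision n)
  have hb := inv_pow_mem_floats_of_le n (k := 3) (by norm_num)
  refine ⟨tokenEmb_mem_floats n, fun _ => swapHead_representable n, fun c q => ?_, fun l c => ?_,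
    fun _ => neg_mem_floats hb, fun _ => h1, h0⟩ <;>
  · simp only [swapTransformer, single_apply]
    split_ifs <;> assumption

/-! ### Error analysis -/

/-- A bound for the errors of rounding to precision `precision n` on the interval `[-7, 7]`. -/
noncomputable def roundErr (n : ℕ) : ℝ := 8 / 2 ^ precision n

theorem roundErr_nonneg (n : ℕ) : 0 ≤ roundErr n := by
  unfold roundErr
  positivity

theorem mul_roundErr_le (n : ℕ) : n * roundErr n ≤ 1 / 10 ^ 8 := by
  have h : (1000000000 * n : ℝ) < 2 ^ precision n := by
    exact_mod_cast mul_lt_two_pow_precision n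
  rw [roundErr, mul_div_assoc', div_le_iff₀ (by positivity)]
  linarith

theorem roundErr_le (n : ℕ) : roundErr n ≤ 1 / 100 := by
  have h : ((1000 : ℕ) : ℝ) < 2 ^ precision n := by
    exact_mod_cast lt_two_pow_precision_of_le n le_rfl
  rw [roundErr, div_le_iff₀ (by positivity)]
  push_cast at h
  linarith

variable {n : ℕ} {r : ℝ → ℝ}

theorem IsRounding.abs_map_sub_le_roundErr (hr : IsRounding (precision n) r) {x : ℝ}
    (hx : |x| ≤ 7) : |r x - x| ≤ roundErr n := by
  have hscale : (2 : ℝ) ^ (3 - precision n : ℤ) = roundErr n := by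
    rw [zpow_sub₀ two_ne_zero, zpow_natCast, roundErr]
    norm_num
  have hexp : |(3 - precision n : ℤ)| < 2 ^ precision n := by
    have hlt : (precision n : ℤ) < 2 ^ precision n := by exact_mod_cast Nat.lt_two_pow_self
    have h3 : (3 : ℤ) ≤ precision n := by simp [precision]; lia
    rw [abs_lt]
    constructor <;> lia
  have hrange : (2 ^ precision n - 1) * roundErr n = 8 - roundErr n := by
    rw [roundErr]
    field_simp
  rw [← hscale]
  refine hr.abs_map_sub_le hexp ?_
  rw [hscale, hrange]
  linarith [roundErr_le n]

theorem swapHead_query (hr : IsRounding (precision n) r) (v : Token) :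
    (swapHead n).query r (tokenEmb v) = fun a => (queryVec n a : ℝ) := by
  funext a
  cases v <;>
    simp [-Nat.reduceAdd, Head.query, roundVec, swapHead, tokenEmb, of_append_mulVec_append,
      hr.exact _ (queryVec_mem_floats n a)]

theorem swapHead_key_start (hr : IsRounding (precision n) r) :
    (swapHead n).key r (tokenEmb .start) = fun a => (startKey a : ℝ) := by
  funext a
  simp [-Nat.reduceAdd, Head.key, roundVec, swapHead, tokenEmb, of_append_mulVec_append,
    hr.exact _ (startKey_mem_floats n a)]

theorem swapHead_key_swap (hr : IsRounding (precision n) r) (s : Swap) :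
    (swapHead n).key r (tokenEmb (.swap s)) = 0 := by
  funext a
  simp [-Nat.reduceAdd, Head.key, roundVec, swapHead, tokenEmb, of_append_mulVec_append,
    hr.map_zero]

theorem swapHead_value_start (hr : IsRounding (precision n) r) :
    (swapHead n).value r (tokenEmb .start) = 1 := by
  funext a
  simp [-Nat.reduceAdd, Head.value, roundVec, swapHead, tokenEmb, of_append_mulVec_append,
    hr.map_one (one_le_precision n)]

theorem swapHead_value_swap (hr : IsRounding (precision n) r) (s : Swap) :
    (swapHead n).value r (tokenEmb (.swap s)) = 0 := by
  funext a
  simp [-Nat.reduceAdd, Head.value, roundVec, swapHead, tokenEmb, of_append_mulVec_append,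
    hr.map_zero]

theorem swapHead_preDir_swap (hr : IsRounding (precision n) r) (s : Swap) :
    (swapHead n).preDir r (tokenEmb (.swap s)) = s.direction := by
  funext a
  simp [-Nat.reduceAdd, Head.preDir, roundVec, swapHead, tokenEmb, of_append_mulVec_append,
    hr.exact _ (direction_mem_floats n s a)]

theorem abs_swapHead_beta_sub_le (hr : IsRounding (precision n) r) (x : Fin (5 + 2) → ℝ) :
    |(swapHead n).beta r x - 2| ≤ 2 * roundErr n := by
  have hb : r (precision n) = precision n := hr.exact _ (swapHead_representable n).2.2.2.2.2
  have hβ : (swapHead n).beta r x = r (2 * Real.sigmoid (precision n)) := by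
    simp [Head.beta, swapHead, hb]
  have hnonneg := Real.sigmoid_nonneg (precision n : ℝ)
  have hle := Real.sigmoid_le_one (precision n : ℝ)
  have hsigmoid := one_sub_sigmoid_natCast_le (precision n)
  have hround := hr.abs_map_sub_le_roundErr (x := 2 * Real.sigmoid (precision n))
    (abs_le.2 ⟨by linarith, by linarith⟩)
  have hinv : (2 ^ precision n)⁻¹ = roundErr n / 8 := by
    rw [roundErr]
    field_simp
  rw [abs_le] at hround ⊢
  rw [hβ]
  constructor <;> linarith [roundErr_nonneg n]

theorem Swap.abs_direction_div_le (s : Swap) (a : Fin 5) : |s.direction a / √2| ≤ 1 := by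
  have hone : |s.direction a| ≤ 1 := by
    rcases s.direction_apply_mem a with h | h | h <;> rw [h] <;> norm_num
  rw [abs_div, abs_of_pos (by positivity : 0 < √2), div_le_one (by positivity)]
  exact hone.trans (Real.one_le_sqrt.2 one_le_two)

theorem abs_swapHead_dir_sub_le (hr : IsRounding (precision n) r) (s : Swap) (a : Fin 5) :
    |(swapHead n).dir r (tokenEmb (.swap s)) a - s.direction a / √2| ≤ roundErr n := by
  rw [Head.dir, swapHead_preDir_swap hr, s.direction_dotProduct_self]
  exact hr.abs_map_sub_le_roundErr ((s.abs_direction_div_le a).trans (by norm_num))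

theorem abs_swapHead_transition_sub_le (hr : IsRounding (precision n) r) (s : Swap)
    (a c : Fin 5) :
    |(swapHead n).transition r (tokenEmb (.swap s)) a c - if a = s.perm c then 1 else 0| ≤
      15 * roundErr n := by
  have hε := roundErr_le n
  have hrank := abs_mul_mul_sub_le (by linarith) (abs_swapHead_beta_sub_le hr (tokenEmb (.swap s)))
    (abs_swapHead_dir_sub_le hr s a) (abs_swapHead_dir_sub_le hr s c) (s.abs_direction_div_le a)
    (s.abs_direction_div_le c)
  have hnormalize : 2 * (s.direction a / √2) * (s.direction c / √2) =
      s.direction a * s.direction c := by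
    field_simp
    rw [Real.sq_sqrt zero_le_two]
    ring
  have hreflection := one_sub_mul_single_sub_single (R := ℝ) s.2 a c
  rw [hnormalize] at hrank
  change _ - s.direction a * s.direction c = if a = s.perm c then 1 else 0 at hreflection
  have hentry : |(if a = s.perm c then 1 else 0 : ℝ)| ≤ 1 := by split_ifs <;> simp
  rw [← hreflection] at hentry ⊢
  have hround := hr.abs_map_sub_le_roundErr (x := (1 : Matrix (Fin 5) (Fin 5) ℝ) a c -
    (swapHead n).beta r (tokenEmb (.swap s)) * (swapHead n).dir r (tokenEmb (.swap s)) a *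
      (swapHead n).dir r (tokenEmb (.swap s)) c) (by
    rw [abs_le] at hrank hentry ⊢
    constructor <;> linarith)
  rw [Head.transition, of_apply]
  rw [abs_le] at hrank hround ⊢
  constructor <;> linarith

/-! ### The attention pattern -/

/-- The embedded input sequence of the transformer. -/
def inputSeq (w : List Swap) (t : ℕ) : Fin (5 + 2) → ℝ := ((tokens w).map tokenEmb).getD t 0

theorem inputSeq_zero (w : List Swap) : inputSeq w 0 = tokenEmb .start := rfl

theorem inputSeq_succ (w : List Swap) {t : ℕ} (ht : t < w.length) :
    inputSeq w (t + 1) = tokenEmb (.swap w[t]) := by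
  simp [inputSeq, tokens, ht]

theorem exists_inputSeq_eq (w : List Swap) {t : ℕ} (ht : t ≤ w.length) :
    ∃ v, inputSeq w t = tokenEmb v := by
  cases t with
  | zero => exact ⟨_, inputSeq_zero w⟩
  | succ t => exact ⟨_, inputSeq_succ w ht⟩

theorem abs_carry_start_sub_le (hr : IsRounding (precision n) r) {w : List Swap}
    (hw : w.length ≤ n) (a : Fin 5) :
    |(swapHead n).carry r (inputSeq w) 0 w.length a - startKey ((w.map Swap.perm).prod a)| ≤
      1 / 199 := by
  have hsmall : w.length * (451 * roundErr n) ≤ 1 / 199 := by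
    have : w.length * roundErr n ≤ n * roundErr n :=
      mul_le_mul_of_nonneg_right (by exact_mod_cast hw) (roundErr_nonneg n)
    linarith [mul_roundErr_le n]
  have hstep : (5 : ℕ) * ((5 + 1) * (15 * roundErr n)) + roundErr n = 451 * roundErr n := by
    push_cast
    ring
  have hkey : ∀ a, |(startKey a : ℝ)| ≤ 5 := fun a => by
    have : |startKey a| ≤ 5 := by revert a; decide
    exact_mod_cast this
  have hcarry := (swapHead n).abs_carry_sub_le (r := r) (X := inputSeq w)
    (l := w.map Swap.perm) (δ := 15 * roundErr n) (ε := roundErr n)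
    (swapHead_key_start hr) hkey
    (fun x hx => hr.abs_map_sub_le_roundErr (hx.trans (by norm_num)))
    (fun t ht a c => by
      rw [List.length_map] at ht
      rw [inputSeq_succ w ht, List.getElem_map]
      exact abs_swapHead_transition_sub_le hr w[t] a c)
    (by rw [hstep, List.length_map]; linarith) le_rfl a
  rw [hstep, List.take_length, List.length_map] at hcarry
  exact hcarry.trans hsmall

theorem carry_swap (hr : IsRounding (precision n) r) {w : List Swap} {j : ℕ} (hj : j < w.length)
    (t : ℕ) : (swapHead n).carry r (inputSeq w) (j + 1) t = 0 := by
  induction t with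
  | zero => rw [Head.carry, inputSeq_succ w hj, swapHead_key_swap hr]
  | succ t ih =>
    rw [Head.carry, ih, zero_vecMul]
    exact funext fun _ => hr.map_zero

theorem score_swap (hr : IsRounding (precision n) r) {w : List Swap} {j : ℕ} (hj : j < w.length)
    (i : ℕ) : (swapHead n).score r (inputSeq w) i (j + 1) = 1 := by
  rw [Head.score, Head.logit, carry_swap hr hj, zero_dotProduct, hr.map_zero, Real.exp_zero,
    hr.map_one (one_le_precision n)]

/-- The logit at the start token in exact arithmetic, when the swaps compose to `σ`. -/
def startLogit (n : ℕ) (σ : Equiv.Perm (Fin 5)) : ℤ := ∑ a, startKey (σ a) * queryVec n a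

theorem startLogit_eq (n : ℕ) (σ : Equiv.Perm (Fin 5)) :
    startLogit n σ = logScale n * (30 * ∑ a, startKey (σ a) * startKey a - 1635) := by
  have hsum : ∑ a, startKey (σ a) = 15 := by rw [Equiv.sum_comp σ startKey]; decide
  calc startLogit n σ
      = ∑ a, logScale n * (30 * (startKey (σ a) * startKey a) - 109 * startKey (σ a)) :=
        Finset.sum_congr rfl fun a _ => by rw [queryVec]; ring
    _ = logScale n * (30 * ∑ a, startKey (σ a) * startKey a - 109 * ∑ a, startKey (σ a)) := by
        simp only [Finset.mul_sum, ← Finset.sum_sub_distrib]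
    _ = _ := by rw [hsum]; norm_num

theorem sum_startKey_mul_self : ∑ a, startKey a * startKey a = 55 := by decide

theorem startKey_injective : Function.Injective startKey := by decide

theorem startLogit_one (n : ℕ) : startLogit n 1 = logScale n * 15 := by
  simp only [startLogit_eq, Equiv.Perm.one_apply, sum_startKey_mul_self]
  norm_num

theorem startLogit_le (n : ℕ) {σ : Equiv.Perm (Fin 5)} (hσ : σ ≠ 1) :
    startLogit n σ ≤ logScale n * -15 := by
  have := sum_startKey_mul_self ▸ sum_mul_perm_lt_sum_mul_self startKey_injective hσ
  rw [startLogit_eq]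
  gcongr
  linarith

theorem sum_abs_queryVec (n : ℕ) : ∑ a, |(queryVec n a : ℝ)| = 199 * logScale n := by
  have h : ∑ a, |queryVec n a| = 199 * logScale n := by
    have hsum : ∑ a, |30 * startKey a - 109| = 199 := by decide
    simp only [queryVec, abs_mul, Nat.abs_cast, ← Finset.mul_sum, hsum, mul_comm]
  exact_mod_cast h

theorem abs_carry_start_dotProduct_sub_le (hr : IsRounding (precision n) r) {w : List Swap}
    (hw : w.length ≤ n) :
    |(swapHead n).carry r (inputSeq w) 0 w.length ⬝ᵥ
        (swapHead n).query r (inputSeq w w.length) - startLogit n (w.map Swap.perm).prod| ≤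
      logScale n := by
  obtain ⟨v, hv⟩ := exists_inputSeq_eq w le_rfl
  have h := abs_dotProduct_sub_le (abs_carry_start_sub_le hr hw) fun a => (queryVec n a : ℝ)
  rw [sum_abs_queryVec, one_div, inv_mul_cancel_left₀ (by norm_num)] at h
  rw [hv, swapHead_query hr, startLogit]
  push_cast
  exact h

theorem logit_start_mem_Icc (hr : IsRounding (precision n) r) {w : List Swap}
    (hw : w.length ≤ n) (hid : (w.map Swap.perm).prod = 1) :
    (swapHead n).logit r (inputSeq w) w.length 0 ∈
      Set.Icc (14 * logScale n : ℝ) (16 * logScale n) := by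
  have h := abs_carry_start_dotProduct_sub_le hr hw
  rw [hid, startLogit_one, abs_le] at h
  push_cast at h
  rw [Head.logit, Nat.sub_zero]
  exact ⟨hr.le_map (by simpa using mul_logScale_mem_floats n (m := 14) (by norm_num))
      (by linarith),
    hr.map_le (by simpa using mul_logScale_mem_floats n (m := 16) (by norm_num)) (by linarith)⟩

theorem logit_start_le (hr : IsRounding (precision n) r) {w : List Swap} (hw : w.length ≤ n)
    (hid : (w.map Swap.perm).prod ≠ 1) :
    (swapHead n).logit r (inputSeq w) w.length 0 ≤ -14 * logScale n := by
  have h := abs_carry_start_dotProduct_sub_le hr hw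
  have hle : (startLogit n (w.map Swap.perm).prod : ℝ) ≤ logScale n * -15 := by
    exact_mod_cast startLogit_le n hid
  rw [abs_le] at h
  rw [Head.logit, Nat.sub_zero]
  exact hr.map_le (by simpa using mul_logScale_mem_floats n (m := -14) (by norm_num))
    (by linarith)

theorem score_start_mem_Icc (hr : IsRounding (precision n) r) {w : List Swap}
    (hw : w.length ≤ n) (hid : (w.map Swap.perm).prod = 1) :
    (swapHead n).score r (inputSeq w) w.length 0 ∈
      Set.Icc ((2 : ℝ) ^ logScale n) (2 ^ (2 * (16 * logScale n))) := by
  obtain ⟨hlow, hhigh⟩ := logit_start_mem_Icc hr hw hid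
  have hlt := mul_logScale_lt_two_pow_precision n
  constructor
  · refine hr.le_map (pow_mem_floats (one_le_precision n) (by lia))
      ((two_pow_le_exp _).trans (Real.exp_le_exp.2 ?_))
    linarith [Nat.cast_nonneg (α := ℝ) (logScale n)]
  · refine hr.map_le (pow_mem_floats (one_le_precision n) (by lia))
      ((Real.exp_le_exp.2 ?_).trans (exp_le_two_pow _))
    exact_mod_cast hhigh

theorem score_start_le (hr : IsRounding (precision n) r) {w : List Swap} (hw : w.length ≤ n)
    (hid : (w.map Swap.perm).prod ≠ 1) :
    (swapHead n).score r (inputSeq w) w.length 0 ≤ (2 ^ 4)⁻¹ := by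
  have hscale : (5 : ℝ) ≤ logScale n := by exact_mod_cast five_le_logScale n
  refine hr.map_le (inv_pow_mem_floats_of_le n (by norm_num)) ?_
  calc Real.exp ((swapHead n).logit r (inputSeq w) w.length 0)
      ≤ Real.exp (-(4 : ℕ)) := by
        gcongr
        push_cast
        linarith [logit_start_le hr hw hid]
    _ ≤ (2 ^ 4)⁻¹ := by
        rw [Real.exp_neg]
        gcongr
        exact two_pow_le_exp 4

theorem normalizer_eq (hr : IsRounding (precision n) r) (w : List Swap) :
    (swapHead n).normalizer r (inputSeq w) w.length =
      r (w.length + (swapHead n).score r (inputSeq w) w.length 0) := by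
  rw [Head.normalizer, Finset.sum_range_succ',
    Finset.sum_congr rfl fun j hj => score_swap hr (Finset.mem_range.1 hj) _]
  simp

theorem inv_four_le_weight_start (hr : IsRounding (precision n) r) {w : List Swap}
    (hw : w.length ≤ n) (hid : (w.map Swap.perm).prod = 1) :
    (2 ^ 2)⁻¹ ≤ (swapHead n).weight r (inputSeq w) w.length 0 := by
  obtain ⟨hlow, hhigh⟩ := score_start_mem_Icc hr hw hid
  have hlength : (w.length : ℝ) ≤ 2 ^ logScale n := by
    exact_mod_cast hw.trans (le_two_pow_logScale n)
  have hlt := mul_logScale_lt_two_pow_precision n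
  have hscale := five_le_logScale n
  rw [Head.weight, normalizer_eq hr]
  exact hr.inv_four_le_map_div (by lia) (Nat.cast_nonneg _) (hlength.trans hlow)
    ((one_le_pow₀ one_le_two).trans hlow) hhigh

theorem weight_start_le (hr : IsRounding (precision n) r) {w : List Swap} (hw : w.length ≤ n)
    (hid : (w.map Swap.perm).prod ≠ 1) :
    (swapHead n).weight r (inputSeq w) w.length 0 ≤ (2 ^ 4)⁻¹ := by
  have hlength : 1 ≤ w.length := List.length_pos_iff.2 (by rintro rfl; exact hid rfl)
  rw [Head.weight, normalizer_eq hr]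
  exact hr.map_div_le (one_le_precision n) (inv_pow_mem_floats_of_le n (by norm_num))
    (hr.le_map zero_mem_floats (Real.exp_nonneg _)) (score_start_le hr hw hid)
    (by exact_mod_cast hlength)

theorem output_eq_weight_start (hr : IsRounding (precision n) r) (w : List Swap) (a : Fin 5) :
    (swapHead n).output r (inputSeq w) w.length a =
      (swapHead n).weight r (inputSeq w) w.length 0 := by
  rw [Head.output, Finset.sum_range_succ', Finset.sum_eq_zero, zero_add, inputSeq_zero,
    swapHead_value_start hr, Pi.one_apply, mul_one]
  · exact hr.map_map _
  · intro j hj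
    rw [inputSeq_succ w (Finset.mem_range.1 hj), swapHead_value_swap hr, Pi.zero_apply, mul_zero]

theorem attention_eq_weight_start (hr : IsRounding (precision n) r) (h : ℕ) [NeZero h]
    (w : List Swap) :
    (swapTransformer h n).attention r (tokens w) w.length 0 =
      (swapHead n).weight r (inputSeq w) w.length 0 := by
  have hproj : (swapTransformer h n).attention r (tokens w) w.length 0 =
      r ((swapHead n).output r (inputSeq w) w.length 0) := by
    rw [OneLayer.attention, roundVec, swapTransformer, single_mulVec, Function.update_self,
      one_mul]
    rfl
  rw [hproj, output_eq_weight_start hr, Head.weight, hr.map_map]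

theorem run_eq_sign (hr : IsRounding (precision n) r) (h : ℕ) [NeZero h] (w : List Swap) :
    (swapTransformer h n).run r (tokens w) =
      r (Real.sign (r ((swapHead n).weight r (inputSeq w) w.length 0 - (2 ^ 3)⁻¹))) := by
  rw [OneLayer.run, OneLayer.ffn, ← attention_eq_weight_start hr h]
  simp [swapTransformer, tokens, single_mulVec, dotProduct, sub_eq_add_neg]

theorem swapTransformer_run (hr : IsRounding (precision n) r) (h : ℕ) [NeZero h] {w : List Swap}
    (hw : w.length ≤ n) :
    (w ∈ swapIdentity → (swapTransformer h n).run r (tokens w) = 1) ∧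
      (w ∉ swapIdentity → (swapTransformer h n).run r (tokens w) = -1) := by
  have hone := one_mem_floats (one_le_precision n)
  constructor <;> intro hid <;> rw [run_eq_sign hr]
  · have hpos := hr.le_map (inv_pow_mem_floats_of_le n (k := 3) (by norm_num))
      (show _ ≤ (swapHead n).weight r (inputSeq w) w.length 0 - (2 ^ 3)⁻¹ by
        linarith [inv_four_le_weight_start hr hw hid])
    rw [Real.sign_of_pos (lt_of_lt_of_le (by positivity) hpos), hr.exact _ hone]
  · have hneg := hr.map_le (neg_mem_floats (inv_pow_mem_floats_of_le n (k := 4) (by norm_num)))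
      (show (swapHead n).weight r (inputSeq w) w.length 0 - (2 ^ 3)⁻¹ ≤ _ by
        linarith [weight_start_le hr hw hid])
    rw [Real.sign_of_neg (lt_of_le_of_lt hneg (by norm_num)), hr.exact _ (neg_mem_floats hone)]

end Transformer

end PaTH

theorem theorem1_general :
    PaTH.InNC1 PaTH.swapIdentity ∧
      (∀ {α : Type} (L : Language α), PaTH.InNC1 L → PaTH.AC0Reducible L PaTH.swapIdentity) ∧
      ∃ (D d k : ℕ) (p : ℕ → ℕ),
        ((fun n : ℕ => (p n : ℝ)) =O[Filter.atTop] fun n : ℕ => Real.log (n : ℝ)) ∧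
          ∀ (h : ℕ) [NeZero h] (n : ℕ), ∃ T : PaTH.OneLayer PaTH.Token h D d k,
            T.Representable (p n) ∧
              ∀ r : ℝ → ℝ, PaTH.IsRounding (p n) r →
                ∀ w : List PaTH.Swap, w.length ≤ n →
                  (w ∈ PaTH.swapIdentity → T.run r (PaTH.tokens w) = 1) ∧
                    (w ∉ PaTH.swapIdentity → T.run r (PaTH.tokens w) = -1) :=
  ⟨PaTH.inNC1_swapIdentity, fun _ => PaTH.ac0Reducible_swapIdentity, 5 + 2, 5, 1, PaTH.precision,
    PaTH.isBigO_precision, fun h _ n => ⟨PaTH.swapTransformer h n,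
      PaTH.swapTransformer_representable h n,
      fun _ hr _ hw => PaTH.swapTransformer_run hr h hw⟩⟩

theorem theorem1 :
    PaTH.NC1Complete PaTH.swapIdentity ∧
      ∃ (D d k : ℕ) (p : ℕ → ℕ),
        ((fun n : ℕ => (p n : ℝ)) =O[Filter.atTop] fun n : ℕ => Real.log (n : ℝ)) ∧
          ∀ n : ℕ, ∃ T : PaTH.OneLayer PaTH.Token 2 D d k,
            T.Representable (p n) ∧
              ∀ r : ℝ → ℝ, PaTH.IsRounding (p n) r →
                ∀ w : List PaTH.Swap, w.length ≤ n →
                  (w ∈ PaTH.swapIdentity → T.run r (PaTH.tokens w) = 1) ∧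
                    (w ∉ PaTH.swapIdentity → T.run r (PaTH.tokens w) = -1) :=
  let ⟨hmem, hhard, D, d, k, p, hp, hrun⟩ := theorem1_general
  ⟨⟨hmem, fun _ _ L hL => hhard L hL⟩, D, d, k, p, hp, hrun 2⟩
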